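/- Let $\mathcal H=L^2(\mathbb R,\mathbb C)$ with inner product $\langle f,g\rangle=\int_{\mathbb R}\overline{f(x)}\,g(x)\,dx$, and let $P=-i\,\frac{d}{dx}$ be the momentum operator (units with $\hbar=1$), whose domain consists of those $f\in\mathcal H$ that are absolutely continuous (on compact intervals) with $f'\in L^2(\mathbb R,\mathbb C)$. Let $\Phi(x)=\pi^{-1/4}e^{-x^2/2}$ be the vacuum vector. A resolution of the identity is a family $(E_\lambda)_{\lambda\in\mathbb R}$ of orthogonal projections on $\mathcal H$ with $E_\lambda E_\mu=E_{\min(\lambda,\mu)}$ that is strongly right-continuous and tends strongly to $0$ as $\lambda\to-\infty$ and to the identity as $\lambda\to+\infty$. For a continuous $\varphi:\mathbb R\to\mathbb C$, the operator $\int_{\mathbb R}\varphi(\lambda)\,dE_\lambda$ is the operator $T$ with domain $\{u:\int|\varphi(\lambda)|^2\,d\langle u,E_\lambda u\rangle<\infty\}$ and $\langle u,Tu\rangle=\int\varphi(\lambda)\,d\langle u,E_\lambda u\rangle$ for all $u$ in this domain. Then $P$ has exactly one spectral resolution, that is, there is exactly one resolution of the identity $(E_\lambda)$ with $P=\int_{\mathbb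 R}\lambda\,dE_\lambda$. The vacuum spectral resolution of $P$ is, for every $\lambda\in\mathbb R$, $$\langle\Phi,E_\lambda\Phi\rangle=\pi^{-1/2}\int_{-\infty}^{\lambda}e^{-s^2}\,ds .$$ Moreover, for every $t\in\mathbb R$, there is exactly one bounded operator $e^{itP}=\int_{\mathbb R}e^{it\lambda}\,dE_\lambda$ on $\mathcal H$, and $$\langle\Phi,e^{itP}\Phi\rangle=e^{-t^2/4}.$$ -/

import Mathlib

open MeasureTheory Filter Topology Set

noncomputable section

/-! ### Resolutions of the identity and spectral integrals -/

/-- A resolution of the identity `(E_x)`, `x ∈ ℝ`, on a complex Hilbert space: orthogonal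
projections, increasing and strongly right-continuous in `x`, which tend strongly to `0` as
`x → -∞` and to the identity as `x → +∞`. -/
@[ext]
structure ResolutionOfIdentity (H : Type*) [NormedAddCommGroup H] [InnerProductSpace ℂ H]
    [CompleteSpace H] where
  /-- the projection `E_x = E((-∞, x])` -/
  proj : ℝ → H →L[ℂ] H
  isStarProjection : ∀ x, IsStarProjection (proj x)
  proj_mul_proj : ∀ x y, proj x * proj y = proj (min x y)
  right_continuous : ∀ (u : H) (x : ℝ), ContinuousWithinAt (fun y => proj y u) (Ici x) x
  tendsto_atBot : ∀ u : H, Tendsto (fun y => proj y u) atBot (𝓝 0)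
  tendsto_atTop : ∀ u : H, Tendsto (fun y => proj y u) atTop (𝓝 u)

namespace ResolutionOfIdentity

variable {H : Type*} [NormedAddCommGroup H] [InnerProductSpace ℂ H] [CompleteSpace H]

theorem inner_proj_eq (E : ResolutionOfIdentity H) (x : ℝ) (u : H) :
    inner ℂ u (E.proj x u) = ((‖E.proj x u‖ ^ 2 : ℝ) : ℂ) := by
  have hid : E.proj x (E.proj x u) = E.proj x u :=
    congrArg (fun T : H →L[ℂ] H => T u) (E.isStarProjection x).isIdempotentElem
  have hsa := ContinuousLinearMap.isSelfAdjoint_iff_isSymmetric.1 (E.isStarProjection x).isSelfAdjoint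
  have h1 : inner ℂ (E.proj x u) (E.proj x u) = inner ℂ u (E.proj x (E.proj x u)) := hsa _ _
  rw [hid] at h1
  rw [← h1, inner_self_eq_norm_sq_to_K]
  norm_cast

theorem monotone_inner_proj (E : ResolutionOfIdentity H) (u : H) :
    Monotone fun x => (inner ℂ u (E.proj x u)).re := by
  intro x y hxy
  simp only [inner_proj_eq, Complex.ofReal_re]
  have hmul : E.proj x u = E.proj x (E.proj y u) := by
    have := congrArg (fun T : H →L[ℂ] H => T u) (E.proj_mul_proj x y)
    simpa [min_eq_left hxy] using this.symm
  have hle : ∀ w : H, ‖E.proj x w‖ ≤ ‖w‖ := by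
    intro w
    have h2 : ‖E.proj x w‖ ^ 2 ≤ ‖w‖ * ‖E.proj x w‖ := by
      have := norm_inner_le_norm (𝕜 := ℂ) w (E.proj x w)
      rw [inner_proj_eq, Complex.norm_real, Real.norm_of_nonneg (by positivity)] at this
      exact this
    by_contra! hlt
    nlinarith [norm_nonneg w]
  have h3 := hle (E.proj y u)
  rw [← hmul] at h3
  exact pow_le_pow_left₀ (norm_nonneg _) h3 2

/-- The increasing right-continuous function `x ↦ ⟨u, E_x u⟩` (its values are real). -/
def stieltjes (E : ResolutionOfIdentity H) (u : H) : StieltjesFunction ℝ where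
  toFun x := (inner ℂ u (E.proj x u)).re
  mono' := E.monotone_inner_proj u
  right_continuous' x :=
    Complex.continuous_re.continuousAt.comp_continuousWithinAt
      (ContinuousWithinAt.inner (𝕜 := ℂ) continuousWithinAt_const (E.right_continuous u x))

/-- The Lebesgue–Stieltjes measure `d⟨u, E_x u⟩` on `ℝ`. -/
def measure (E : ResolutionOfIdentity H) (u : H) : Measure ℝ := (E.stieltjes u).measure

/-- `T = ∫ φ(x) dE_x`: the domain of `T` consists of the `u` with `∫ |φ(x)|² d⟨u, E_x u⟩ < ∞`,
and `⟨u, T u⟩ = ∫ φ(x) d⟨u, E_x u⟩` for each `u` in the domain. (As the domain is a dense subspace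
of a complex Hilbert space, by polarization the second condition determines `T`.) -/
def IsSpectralIntegral (E : ResolutionOfIdentity H) (φ : ℝ → ℂ) (T : H →ₗ.[ℂ] H) : Prop :=
  (∀ u : H, u ∈ T.domain ↔ MemLp φ 2 (E.measure u)) ∧
    ∀ u : T.domain, inner ℂ (u : H) (T u) = ∫ x, φ x ∂(E.measure (u : H))

/-- `E` is a spectral resolution of the operator `A`, that is, `A = ∫ x dE_x`. -/
def IsSpectralResolution (E : ResolutionOfIdentity H) (A : H →ₗ.[ℂ] H) : Prop :=
  E.IsSpectralIntegral (fun x => (x : ℂ)) A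

/-- The bounded operator `U`, defined on the whole space, is `∫ e^{itx} dE_x`. This is `e^{itA}`
when `E` is the spectral resolution of `A`. -/
def IsExpI (E : ResolutionOfIdentity H) (t : ℝ) (U : H →L[ℂ] H) : Prop :=
  E.IsSpectralIntegral (fun x => Complex.exp (Complex.I * t * x)) ((U : H →ₗ[ℂ] H).toPMap ⊤)

end ResolutionOfIdentity

/-! ### The momentum operator and the vacuum vector -/

/-- The Hilbert space `L²(ℝ, ℂ)`; its inner product is `⟨f, g⟩ = ∫ conj (f x) * g x dx`. -/
abbrev L2R : Type := Lp ℂ 2 (volume : Measure ℝ)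

/-- The graph of `P = -i d/dx`: the pairs `(f, h)` in `L² × L²` such that `f` has a
representative `F` that is absolutely continuous (on each compact interval) and `h = -i F'`, that
is, `F' = i h`, almost everywhere. -/
def momentumGraph : Submodule ℂ (L2R × L2R) where
  carrier := {p | ∃ F : ℝ → ℂ, (p.1 =ᵐ[volume] F) ∧
    (∀ a b : ℝ, AbsolutelyContinuousOnInterval F a b) ∧
    ∀ᵐ x : ℝ, HasDerivAt F (Complex.I * p.2 x) x}
  add_mem' := by
    rintro p q ⟨F, hF, hFa, hFd⟩ ⟨G, hG, hGa, hGd⟩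
    refine ⟨F + G, (Lp.coeFn_add _ _).trans (hF.add hG), fun a b => (hFa a b).add (hGa a b), ?_⟩
    filter_upwards [hFd, hGd, Lp.coeFn_add p.2 q.2] with x h1 h2 h3
    have h4 := h1.add h2
    rw [← mul_add] at h4
    rw [Prod.snd_add, h3]
    exact h4
  zero_mem' := by
    refine ⟨0, Lp.coeFn_zero _ _ _, fun a b => ?_, ?_⟩
    · exact (LipschitzWith.const (0 : ℂ)).lipschitzOnWith.absolutelyContinuousOnInterval
    · filter_upwards [Lp.coeFn_zero ℂ 2 (volume : Measure ℝ)] with x hx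
      have : Complex.I * (((0 : L2R × L2R).2 : L2R) : ℝ → ℂ) x = 0 := by
        rw [Prod.snd_zero, hx]; simp
      rw [this]
      exact hasDerivAt_const x (0 : ℂ)
  smul_mem' := by
    rintro c p ⟨F, hF, hFa, hFd⟩
    refine ⟨c • F, (Lp.coeFn_smul _ _).trans (hF.const_smul c), fun a b => (hFa a b).const_smul c, ?_⟩
    filter_upwards [hFd, Lp.coeFn_smul c p.2] with x h1 h3
    have h4 := h1.const_smul c
    rw [Prod.smul_snd, h3]
    have h5 : Complex.I * (c • (p.2 : ℝ → ℂ)) x = c • (Complex.I * p.2 x) := by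
      simp only [Pi.smul_apply, smul_eq_mul]
      ring
    rw [h5]
    exact h4

/-- The graph is single-valued, so that it is the graph of an operator. -/
theorem momentumGraph_single_valued (p : L2R × L2R) (hp : p ∈ momentumGraph) (h0 : p.1 = 0) :
    p.2 = 0 := by
  obtain ⟨F, hF, hFa, hFd⟩ := hp
  have hcont : Continuous F := by
    rw [continuous_iff_continuousAt]
    intro x
    refine (hFa (x - 1) (x + 1)).continuousOn.continuousAt ?_
    rw [uIcc_of_le (by linarith)]
    exact Icc_mem_nhds (by linarith) (by linarith)
  have hF0 : F =ᵐ[volume] (fun _ => (0 : ℂ)) := by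
    rw [h0] at hF
    exact hF.symm.trans (Lp.coeFn_zero _ _ _)
  have hF1 : F = fun _ => (0 : ℂ) := hcont.ae_eq_iff_eq volume continuous_const |>.1 hF0
  apply Lp.ext
  filter_upwards [hFd, Lp.coeFn_zero ℂ 2 (volume : Measure ℝ)] with x h1 h2
  rw [hF1] at h1
  have h3 := h1.unique (hasDerivAt_const x (0 : ℂ))
  rw [h2]
  simpa using h3

/-- The momentum operator `P = -i d/dx` in `L²(ℝ, ℂ)`, with domain the `f` in `L²` that are
absolutely continuous with `f'` in `L²`. -/
def momentum : L2R →ₗ.[ℂ] L2R := momentumGraph.toLinearPMap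

theorem momentum_graph : momentum.graph = momentumGraph :=
  Submodule.toLinearPMap_graph_eq _ momentumGraph_single_valued

/-- The function `x ↦ π^{-1/4} e^{-x²/2}`. -/
def vacuumFun (x : ℝ) : ℂ := ((Real.pi ^ (-(1 / 4) : ℝ) * Real.exp (-x ^ 2 / 2) : ℝ) : ℂ)

theorem memLp_vacuumFun : MemLp vacuumFun 2 (volume : Measure ℝ) := by
  have hc : Continuous vacuumFun := by unfold vacuumFun; fun_prop
  rw [memLp_two_iff_integrable_sq_norm hc.aestronglyMeasurable]
  have h := (integrable_exp_neg_mul_sq (b := 1) one_pos).const_mul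
    ((Real.pi ^ (-(1 / 4) : ℝ)) ^ 2)
  refine h.congr (Eventually.of_forall fun x => ?_)
  simp only [vacuumFun, Complex.norm_real, Real.norm_eq_abs, sq_abs, mul_pow, ← Real.exp_nat_mul]
  congr 2
  push_cast
  ring

/-- The vacuum vector `Φ(x) = π^{-1/4} e^{-x²/2}` in `L²(ℝ, ℂ)`. -/
def vacuum : L2R := memLp_vacuumFun.toLp vacuumFun

end

noncomputable section

/-! The unitary Fourier transform $F$, with kernel $e^{-2\pi i x\xi}$, turns $P$ into multiplication
by $s(\xi)=2\pi\xi$ on its maximal domain (`isMulModel_momentum`). Cutting off by the indicators of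
$\{s\le x\}$ gives a resolution of the identity whose measures are the images under $s$ of
$|Fu|^2\,d\xi$, so it is a spectral resolution of $P$ (`IsMulModel.isSpectralIntegral`).

For uniqueness (`IsMulModel.eq_mulResolution`), let $E$ be any spectral resolution. On the range of
$E((a,b])$ the form of $P-c$, with $c$ the midpoint, is at most $(b-a)/2$. The range is invariant
and $P$ is symmetric, so the norm of $P-c$ there obeys the same bound. Hence
$\|(s-c)^nFu\|\le((b-a)/2)^n\|u\|$ for all $n$, which forces $Fu$ to vanish where $s\notin[a,b]$.
This support property and right continuity identify $E$ with the multiplication resolution.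

The vacuum formulas are Gaussian integrals: $|F\Phi|^2\,d\xi$ becomes $\pi^{-1/2}e^{-s^2}ds$ under
$s=2\pi\xi$ (`inner_vacuum_conjMul`). -/

theorem inner_self_eq_ofReal_norm_sq {K : Type*} [NormedAddCommGroup K] [InnerProductSpace ℂ K]
    (u : K) : inner ℂ u u = ((‖u‖ ^ 2 : ℝ) : ℂ) := by
  rw [inner_self_eq_norm_sq_to_K]
  norm_cast

/-! ### Spectral measures of a resolution of the identity -/

namespace ResolutionOfIdentity

variable {H : Type*} [NormedAddCommGroup H] [InnerProductSpace ℂ H] [CompleteSpace H]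

theorem proj_proj_apply (E : ResolutionOfIdentity H) (x y : ℝ) (u : H) :
    E.proj x (E.proj y u) = E.proj (min x y) u :=
  congrArg (fun T : H →L[ℂ] H => T u) (E.proj_mul_proj x y)

theorem inner_proj_left (E : ResolutionOfIdentity H) (x : ℝ) (u v : H) :
    inner ℂ (E.proj x u) v = inner ℂ u (E.proj x v) :=
  ContinuousLinearMap.isSelfAdjoint_iff_isSymmetric.1 (E.isStarProjection x).isSelfAdjoint u v

theorem stieltjes_apply (E : ResolutionOfIdentity H) (u : H) (x : ℝ) :
    E.stieltjes u x = ‖E.proj x u‖ ^ 2 := by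
  change (inner ℂ u (E.proj x u)).re = _
  rw [inner_proj_eq, Complex.ofReal_re]

theorem tendsto_stieltjes_atBot (E : ResolutionOfIdentity H) (u : H) :
    Tendsto (E.stieltjes u) atBot (𝓝 0) := by
  have := ((E.tendsto_atBot u).norm.pow 2)
  simpa [← stieltjes_apply] using this

theorem tendsto_stieltjes_atTop (E : ResolutionOfIdentity H) (u : H) :
    Tendsto (E.stieltjes u) atTop (𝓝 (‖u‖ ^ 2)) := by
  have := ((E.tendsto_atTop u).norm.pow 2)
  simpa [← stieltjes_apply] using this

theorem measure_univ (E : ResolutionOfIdentity H) (u : H) :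
    E.measure u univ = ENNReal.ofReal (‖u‖ ^ 2) := by
  have := (E.stieltjes u).measure_univ (E.tendsto_stieltjes_atBot u) (E.tendsto_stieltjes_atTop u)
  rwa [sub_zero] at this

instance isFiniteMeasure_measure (E : ResolutionOfIdentity H) (u : H) :
    IsFiniteMeasure (E.measure u) :=
  ⟨by rw [measure_univ]; exact ENNReal.ofReal_lt_top⟩

theorem measure_Iic (E : ResolutionOfIdentity H) (u : H) (x : ℝ) :
    E.measure u (Iic x) = ENNReal.ofReal (‖E.proj x u‖ ^ 2) := by
  have := (E.stieltjes u).measure_Iic (E.tendsto_stieltjes_atBot u) x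
  rw [stieltjes_apply, sub_zero] at this
  exact this

theorem measure_Ioi (E : ResolutionOfIdentity H) (u : H) (x : ℝ) :
    E.measure u (Ioi x) = ENNReal.ofReal (‖u‖ ^ 2 - ‖E.proj x u‖ ^ 2) := by
  have := (E.stieltjes u).measure_Ioi (E.tendsto_stieltjes_atTop u) x
  rw [stieltjes_apply] at this
  exact this

theorem measure_add (E : ResolutionOfIdentity H) {u v : H}
    (h : ∀ x, inner ℂ u (E.proj x v) = 0) :
    E.measure (u + v) = E.measure u + E.measure v := by
  have h' : ∀ x, inner ℂ v (E.proj x u) = 0 := fun x => by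
    rw [← inner_conj_symm, inner_proj_left, h, map_zero]
  have : E.stieltjes (u + v) = E.stieltjes u + E.stieltjes v := by
    ext x
    change (inner ℂ (u + v) (E.proj x (u + v))).re =
      (inner ℂ u (E.proj x u)).re + (inner ℂ v (E.proj x v)).re
    simp [h, h']
  rw [measure, this, StieltjesFunction.measure_add]
  rfl

theorem measure_smul (E : ResolutionOfIdentity H) (u : H) {c : ℂ} (hc : ‖c‖ = 1) :
    E.measure (c • u) = E.measure u := by
  have : E.stieltjes (c • u) = E.stieltjes u := by
    ext x
    simp [stieltjes_apply, norm_smul, hc]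
  rw [measure, this]
  rfl

/-! ### Vectors in the range of $E((a,b])$ -/

variable {E : ResolutionOfIdentity H} {a b : ℝ}

theorem proj_eq_self_of_le (hab : a ≤ b) {u : H} (hu : E.proj b u - E.proj a u = u) {x : ℝ}
    (hx : b ≤ x) : E.proj x u = u := by
  rw [← hu, map_sub, proj_proj_apply, proj_proj_apply, min_eq_right hx,
    min_eq_right (hab.trans hx)]

theorem proj_eq_zero_of_le (hab : a ≤ b) {u : H} (hu : E.proj b u - E.proj a u = u) {x : ℝ}
    (hx : x ≤ a) : E.proj x u = 0 := by
  rw [← hu, map_sub, proj_proj_apply, proj_proj_apply, min_eq_left hx,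
    min_eq_left (hx.trans hab), sub_self]

theorem sub_proj_idem (hab : a ≤ b) (u : H) :
    E.proj b (E.proj b u - E.proj a u) - E.proj a (E.proj b u - E.proj a u) =
      E.proj b u - E.proj a u := by
  simp [proj_proj_apply, min_eq_left hab, min_eq_right hab]

theorem ae_mem_Ioc (hab : a ≤ b) {u : H} (hu : E.proj b u - E.proj a u = u) :
    ∀ᵐ x ∂(E.measure u), x ∈ Ioc a b := by
  have h1 : E.measure u (Iic a) = 0 := by
    rw [measure_Iic, proj_eq_zero_of_le hab hu le_rfl]; simp
  have h2 : E.measure u (Ioi b) = 0 := by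
    rw [measure_Ioi, proj_eq_self_of_le hab hu le_rfl]; simp
  rw [← compl_mem_ae_iff] at h1 h2
  filter_upwards [h1, h2] with x hx1 hx2
  exact ⟨not_le.1 hx1, not_lt.1 hx2⟩

variable {A : H →ₗ.[ℂ] H}

theorem IsSpectralResolution.mem_domain (hA : E.IsSpectralResolution A) (hab : a ≤ b) {u : H}
    (hu : E.proj b u - E.proj a u = u) : u ∈ A.domain := by
  rw [hA.1]
  refine MemLp.of_bound (by fun_prop) (max |a| |b|) ?_
  filter_upwards [ae_mem_Ioc hab hu] with x hx
  rw [Complex.norm_real, Real.norm_eq_abs]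
  exact abs_le_max_abs_abs hx.1.le hx.2

theorem IsSpectralResolution.integrable (hA : E.IsSpectralResolution A) (u : A.domain) :
    Integrable (fun x : ℝ => (x : ℂ)) (E.measure (u : H)) :=
  ((hA.1 u).1 u.2).integrable (by norm_num)

theorem inner_sub_proj (u v : H) : inner ℂ (E.proj b u - E.proj a u) v =
    inner ℂ u (E.proj b v - E.proj a v) := by
  rw [inner_sub_left, inner_sub_right, inner_proj_left, inner_proj_left]

theorem proj_sub_proj_comm (x : ℝ) (u : H) :
    E.proj x (E.proj b u - E.proj a u) = E.proj b (E.proj x u) - E.proj a (E.proj x u) := by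
  simp [proj_proj_apply, min_comm]

/-- A spectral resolution prescribes only the diagonal values $\langle u,Au\rangle$. The hypothesis
makes the measure of $v+cu$ additive for $|c|=1$, so the cross terms cancel; $c=1$ and $c=i$ then
separate $\langle v,Au\rangle$ from $\langle u,Av\rangle$. -/
theorem IsSpectralResolution.inner_eq_zero (hA : E.IsSpectralResolution A) {u v : A.domain}
    (h : ∀ x, inner ℂ (v : H) (E.proj x (u : H)) = 0) : inner ℂ (v : H) (A u) = 0 := by
  have key : ∀ c : ℂ, ‖c‖ = 1 →
      c * inner ℂ (v : H) (A u) + (starRingEnd ℂ) c * inner ℂ (u : H) (A v) = 0 := by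
    intro c hc
    have h1 : E.measure ((v + c • u : A.domain) : H) =
        E.measure (v : H) + E.measure (u : H) := by
      have : ((v + c • u : A.domain) : H) = (v : H) + c • (u : H) := rfl
      rw [this, measure_add E (by intro x; simp [h]), measure_smul E _ hc]
    have h2 := hA.2 (v + c • u)
    rw [h1, integral_add_measure (hA.integrable v) (hA.integrable u), ← hA.2 v, ← hA.2 u,
      A.map_add, A.map_smul] at h2
    have h3 : (starRingEnd ℂ) c * c = 1 := by
      rw [← Complex.normSq_eq_conj_mul_self, Complex.normSq_eq_norm_sq, hc]; simp
    simp only [Submodule.coe_add, Submodule.coe_smul, inner_add_left, inner_add_right,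
      inner_smul_left, inner_smul_right] at h2
    linear_combination h2 - inner ℂ (u : H) (A u) * h3
  have h1 := key 1 (by simp)
  have h2 := key Complex.I (by simp)
  simp only [map_one, one_mul, Complex.conj_I] at h1 h2
  linear_combination h1 / 2 - Complex.I / 2 * h2 +
    (inner ℂ (v : H) (A u) - inner ℂ (u : H) (A v)) / 2 * Complex.I_mul_I

/-- Invariance of the spectral subspace. With $G=E_b-E_a$ and $w$ in the domain, $w-Gw$ is
orthogonal to every $E_xu$, hence to $Au$. So $(1-G)Au$ is orthogonal to the domain, which is dense.
-/
theorem IsSpectralResolution.sub_proj_apply (hA : E.IsSpectralResolution A) (hab : a ≤ b)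
    {u : A.domain} (hu : E.proj b (u : H) - E.proj a (u : H) = u) :
    E.proj b (A u) - E.proj a (A u) = A u := by
  have hdom : ∀ w ∈ A.domain, inner ℂ w (A u - (E.proj b (A u) - E.proj a (A u))) = 0 := by
    intro w hw
    have hGw := hA.mem_domain hab (sub_proj_idem (E := E) hab w)
    set v : A.domain := ⟨w, hw⟩ - ⟨_, hGw⟩ with hv
    have hvc : (v : H) = w - (E.proj b w - E.proj a w) := rfl
    have h0 : inner ℂ (v : H) (A u) = 0 := by
      refine hA.inner_eq_zero fun x => ?_
      rw [← hu, proj_sub_proj_comm, ← inner_sub_proj, hvc]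
      have : E.proj b (w - (E.proj b w - E.proj a w)) - E.proj a (w - (E.proj b w - E.proj a w))
          = 0 := by
        rw [map_sub, map_sub (E.proj a), sub_sub_sub_comm, sub_proj_idem hab, sub_self]
      rw [this, inner_zero_left]
    rw [inner_sub_right, ← inner_sub_proj, ← inner_sub_left, ← hvc, h0]
  set z := A u - (E.proj b (A u) - E.proj a (A u)) with hz
  -- Density in the form needed: the truncations $E((-n,n])z$ lie in the domain and tend to $z$, so
  -- $\langle z,z\rangle=0$.
  have hz0 : ∀ n : ℕ, inner ℂ (E.proj n z - E.proj (-n : ℝ) z) z = 0 := fun n =>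
    hdom _ (hA.mem_domain (by linarith [n.cast_nonneg (α := ℝ)])
      (sub_proj_idem (E := E) (by linarith [n.cast_nonneg (α := ℝ)]) z))
  have hlim : Tendsto (fun n : ℕ => E.proj n z - E.proj (-n : ℝ) z) atTop (𝓝 (z - 0)) :=
    ((E.tendsto_atTop z).comp tendsto_natCast_atTop_atTop).sub
      ((E.tendsto_atBot z).comp (tendsto_neg_atTop_atBot.comp tendsto_natCast_atTop_atTop))
  have h2 := hlim.inner (𝕜 := ℂ) (tendsto_const_nhds (x := z))
  simp only [hz0, sub_zero] at h2
  have h3 : z = 0 := inner_self_eq_zero.1 (tendsto_nhds_unique h2 tendsto_const_nhds)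
  exact (sub_eq_zero.1 h3).symm

/-- The quadratic form of `A - c`, where `c` is the midpoint of `[a, b]`, is bounded by half the
length of `[a, b]` on the spectral subspace of `(a, b]`. -/
theorem IsSpectralResolution.norm_inner_sub_le (hA : E.IsSpectralResolution A) (hab : a ≤ b)
    {u : A.domain} (hu : E.proj b (u : H) - E.proj a (u : H) = u) :
    ‖inner ℂ (u : H) (A u - (((a + b) / 2 : ℝ) : ℂ) • (u : H))‖ ≤ (b - a) / 2 * ‖(u : H)‖ ^ 2 := by
  have h1 : inner ℂ (u : H) (A u - (((a + b) / 2 : ℝ) : ℂ) • (u : H)) =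
      ∫ x : ℝ, ((x : ℂ) - ((a + b) / 2 : ℝ)) ∂(E.measure (u : H)) := by
    rw [integral_sub (hA.integrable u) (integrable_const _), integral_const, inner_sub_right,
      hA.2 u, inner_smul_right, inner_self_eq_ofReal_norm_sq, measureReal_def, measure_univ,
      ENNReal.toReal_ofReal (by positivity), Complex.real_smul, mul_comm]
  rw [h1]
  refine (norm_integral_le_of_norm_le_const (C := (b - a) / 2) ?_).trans_eq ?_
  · filter_upwards [ae_mem_Ioc hab hu] with x hx
    rw [← Complex.ofReal_sub, Complex.norm_real, Real.norm_eq_abs, abs_le]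
    constructor <;> linarith [hx.1, hx.2]
  · rw [measureReal_def, measure_univ, ENNReal.toReal_ofReal (by positivity)]

end ResolutionOfIdentity

/-- If the quadratic form of a symmetric operator `B` is bounded by `r` on an invariant subspace,
so is its norm. -/
theorem LinearMap.IsSymmetric.norm_le_of_norm_inner_le {K : Type*} [NormedAddCommGroup K]
    [InnerProductSpace ℂ K] {B : K →ₗ[ℂ] K} (hB : B.IsSymmetric) {r : ℝ}
    (h : ∀ u, ‖inner ℂ u (B u)‖ ≤ r * ‖u‖ ^ 2) (u : K) : ‖B u‖ ≤ r * ‖u‖ := by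
  rcases eq_or_ne (B u) 0 with h0 | h0
  · by_cases hu : u = 0
    · simp [hu]
    · have := h u
      rw [h0, inner_zero_right, norm_zero] at this
      rw [h0, norm_zero]
      have hpos := norm_pos_iff.2 hu
      have : 0 ≤ r * ‖u‖ * ‖u‖ := by linarith [sq ‖u‖, mul_assoc r ‖u‖ ‖u‖]
      exact nonneg_of_mul_nonneg_left this hpos
  have hBu := norm_pos_iff.2 h0
  have hu : 0 < ‖u‖ := norm_pos_iff.2 fun hu => h0 (by rw [hu, map_zero])
  -- This scaling gives $v=tBu$ the norm of $u$. Polarization at $u\pm v$ together with the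
  -- parallelogram law then gives the sharp constant $r$.
  set t : ℝ := ‖u‖ / ‖B u‖ with ht
  have htp : 0 < t := by positivity
  set v : K := (t : ℂ) • B u with hv
  have hnv : ‖v‖ = ‖u‖ := by
    rw [hv, norm_smul, Complex.norm_real, Real.norm_of_nonneg htp.le, ht,
      div_mul_cancel₀ _ hBu.ne']
  have e1 : inner ℂ v (B u) = ((t * ‖B u‖ ^ 2 : ℝ) : ℂ) := by
    rw [hv, inner_smul_left, inner_self_eq_ofReal_norm_sq, Complex.conj_ofReal,
      Complex.ofReal_mul]
  have e2 : inner ℂ u (B v) = ((t * ‖B u‖ ^ 2 : ℝ) : ℂ) := by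
    rw [← hB, ← inner_conj_symm, e1, Complex.conj_ofReal]
  have e3 : inner ℂ (u + v) (B (u + v)) - inner ℂ (u - v) (B (u - v)) =
      ((4 * (t * ‖B u‖ ^ 2) : ℝ) : ℂ) := by
    simp only [map_add, map_sub, inner_add_left, inner_add_right, inner_sub_left, inner_sub_right,
      e1, e2]
    push_cast
    ring
  have e4 := (norm_sub_le (inner ℂ (u + v) (B (u + v))) (inner ℂ (u - v) (B (u - v)))).trans
    (add_le_add (h _) (h _))
  rw [e3, Complex.norm_real, Real.norm_of_nonneg (by positivity), ← mul_add] at e4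
  have e5 := parallelogram_law_with_norm ℂ u v
  have e6 : t * ‖B u‖ = ‖u‖ := div_mul_cancel₀ _ hBu.ne'
  have e7 : ‖u‖ * ‖B u‖ ≤ ‖u‖ * (r * ‖u‖) := by
    have : r * (‖u + v‖ ^ 2 + ‖u - v‖ ^ 2) = r * (2 * (‖u‖ * ‖u‖ + ‖u‖ * ‖u‖)) := by
      rw [e5, hnv]; ring
    rw [this] at e4
    nlinarith
  exact le_of_mul_le_mul_left e7 hu

/-! ### Restriction of the operator to spectral subspaces -/

namespace ResolutionOfIdentity

variable {H : Type*} [NormedAddCommGroup H] [InnerProductSpace ℂ H] [CompleteSpace H]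
  {E : ResolutionOfIdentity H} {a b : ℝ} {A : H →ₗ.[ℂ] H}

variable (E a b) in
/-- The range of the spectral projection `E((a, b])`. -/
def spectralSubspace : Submodule ℂ H where
  carrier := {u | E.proj b u - E.proj a u = u}
  add_mem' {u v} hu hv := by
    simp only [mem_ofPred_eq] at *
    rw [map_add, map_add, add_sub_add_comm, hu, hv]
  zero_mem' := by simp
  smul_mem' c u hu := by
    simp only [mem_ofPred_eq] at *
    rw [map_smul, map_smul, ← smul_sub, hu]

/-- The restriction of `A - c` to the spectral subspace of `(a, b]`. -/
def IsSpectralResolution.restrict (hA : E.IsSpectralResolution A) (hab : a ≤ b) (c : ℂ) :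
    E.spectralSubspace a b →ₗ[ℂ] E.spectralSubspace a b where
  toFun u := ⟨A ⟨u, hA.mem_domain hab u.2⟩ - c • (u : H), Submodule.sub_mem _
    (hA.sub_proj_apply hab (u := ⟨u, hA.mem_domain hab u.2⟩) u.2) (Submodule.smul_mem _ _ u.2)⟩
  map_add' u v := by
    ext
    have := A.map_add ⟨u, hA.mem_domain hab u.2⟩ ⟨v, hA.mem_domain hab v.2⟩
    simp only [Submodule.coe_add, smul_add, ← add_sub_add_comm, ← this]
    rfl
  map_smul' k u := by
    ext
    have := A.map_smul k ⟨u, hA.mem_domain hab u.2⟩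
    simp only [RingHom.id_apply, Submodule.coe_smul, smul_sub, ← this, smul_comm k c]
    rfl

theorem IsSpectralResolution.norm_restrict_le (hA : E.IsSpectralResolution A) (hab : a ≤ b)
    (hsymm : ∀ u v : A.domain, inner ℂ (A u) (v : H) = inner ℂ (u : H) (A v))
    (u : E.spectralSubspace a b) :
    ‖hA.restrict hab ((a + b) / 2 : ℝ) u‖ ≤ (b - a) / 2 * ‖u‖ := by
  refine LinearMap.IsSymmetric.norm_le_of_norm_inner_le ?_ ?_ u
  · intro u v
    have := hsymm ⟨u, hA.mem_domain hab u.2⟩ ⟨v, hA.mem_domain hab v.2⟩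
    change inner ℂ (A _ - _ • (u : H)) (v : H) = inner ℂ (u : H) (A _ - _ • (v : H))
    rw [inner_sub_left, inner_sub_right, this, inner_smul_left, inner_smul_right,
      Complex.conj_ofReal]
  · intro u
    exact hA.norm_inner_sub_le hab (u := ⟨u, hA.mem_domain hab u.2⟩) u.2

end ResolutionOfIdentity

/-! ### Multiplication operators on `L²` -/

/-- Multiplication by an essentially bounded function on `L²(ℝ, ℂ)`. -/
def lpMul {m : ℝ → ℂ} (hm : MemLp m ⊤ (volume : Measure ℝ)) : L2R →L[ℂ] L2R :=
  (ContinuousLinearMap.mul ℂ ℂ).holderL volume ⊤ 2 2 (hm.toLp m)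

theorem coeFn_lpMul {m : ℝ → ℂ} (hm : MemLp m ⊤ (volume : Measure ℝ)) (f : L2R) :
    lpMul hm f =ᵐ[volume] fun x => m x * f x := by
  have h : lpMul hm f =ᵐ[volume] fun x => hm.toLp m x * f x :=
    (ContinuousLinearMap.mul ℂ ℂ).coeFn_holder (hm.toLp m) f
  filter_upwards [h, hm.coeFn_toLp] with x h1 h2
  rw [h1, h2]

theorem L2R.ofReal_norm_sq (f : L2R) :
    ENNReal.ofReal (‖f‖ ^ 2) = ∫⁻ x, ‖f x‖ₑ ^ 2 := by
  have h := eLpNorm_nnreal_pow_eq_lintegral (f := f) (μ := volume) (p := 2) (by norm_num)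
  rw [ENNReal.ofReal_pow (norm_nonneg _), ofReal_norm, Lp.enorm_def]
  simpa using h

/-- Dominated convergence for $\int|m_i-m_0|^2|f|^2$, with majorant $C^2|f|^2$. -/
theorem tendsto_lpMul {ι : Type*} {l : Filter ι} [l.IsCountablyGenerated] {m : ι → ℝ → ℂ}
    {m₀ : ℝ → ℂ} (hm : ∀ i, MemLp (m i) ⊤ (volume : Measure ℝ))
    (hm₀ : MemLp m₀ ⊤ (volume : Measure ℝ)) {C : ℝ} (hC : ∀ i x, ‖m i x - m₀ x‖ ≤ C)
    (hlim : ∀ x, Tendsto (fun i => m i x) l (𝓝 (m₀ x))) (f : L2R) :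
    Tendsto (fun i => lpMul (hm i) f) l (𝓝 (lpMul hm₀ f)) := by
  rw [Lp.tendsto_Lp_iff_tendsto_eLpNorm']
  have key : ∀ i, eLpNorm (⇑(lpMul (hm i) f) - ⇑(lpMul hm₀ f)) 2 volume =
      (∫⁻ x, ‖m i x - m₀ x‖ₑ ^ 2 * ‖f x‖ₑ ^ 2) ^ (1 / 2 : ℝ) := by
    intro i
    rw [eLpNorm_eq_lintegral_rpow_enorm_toReal (by norm_num) (by norm_num)]
    congr 1
    apply lintegral_congr_ae
    filter_upwards [coeFn_lpMul (hm i) f, coeFn_lpMul hm₀ f] with x h1 h2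
    simp [h1, h2, ← sub_mul, mul_pow]
  simp_rw [key]
  have h0 : (0 : ENNReal) = (∫⁻ _ : ℝ, 0) ^ (1 / 2 : ℝ) := by simp
  rw [h0]
  refine (ENNReal.continuous_rpow_const.tendsto _).comp ?_
  have hfin : ∫⁻ x, ‖f x‖ₑ ^ 2 ≠ ⊤ := by
    rw [← L2R.ofReal_norm_sq]; exact ENNReal.ofReal_ne_top
  refine tendsto_lintegral_filter_of_dominated_convergence'
    (fun x => ENNReal.ofReal C ^ 2 * ‖f x‖ₑ ^ 2) ?_ ?_ ?_ ?_
  · refine Eventually.of_forall fun i => ?_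
    exact ((((hm i).1.sub hm₀.1).enorm).pow_const 2).mul
      ((Lp.stronglyMeasurable f).aestronglyMeasurable.enorm.pow_const 2)
  · refine Eventually.of_forall fun i => Eventually.of_forall fun x => ?_
    gcongr
    rw [← ofReal_norm]
    exact ENNReal.ofReal_le_ofReal (hC i x)
  · rw [lintegral_const_mul' _ _ (by finiteness)]
    exact ENNReal.mul_ne_top (by finiteness) hfin
  · refine Eventually.of_forall fun x => ?_
    have h1 : Tendsto (fun i => m i x - m₀ x) l (𝓝 0) := by
      simpa using (hlim x).sub_const (m₀ x)
    have h2 : Tendsto (fun i => ‖m i x - m₀ x‖ₑ ^ 2 * ‖f x‖ₑ ^ 2) l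
        (𝓝 (‖(0 : ℂ)‖ₑ ^ 2 * ‖f x‖ₑ ^ 2)) :=
      ENNReal.Tendsto.mul_const ((ENNReal.continuous_pow 2).tendsto _ |>.comp h1.enorm)
        (Or.inr (by finiteness))
    simpa using h2

theorem inner_eq_integral_of_ae {f g k : L2R} {m : ℝ → ℂ} (hg : g =ᵐ[volume] fun x => m x * k x) :
    inner ℂ f g = ∫ x, m x * ((starRingEnd ℂ) (f x) * k x) := by
  rw [L2.inner_def]
  apply integral_congr_ae
  filter_upwards [hg] with x hx
  rw [hx, RCLike.inner_apply']
  ring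

/-! ### The spectral measure of a multiplication operator -/

/-- The measure `B ↦ ∫_{s ∈ B} |f|²`. -/
def mulMeasure (s : ℝ → ℝ) (f : L2R) : Measure ℝ :=
  (volume.withDensity fun x => ((‖f x‖₊ ^ 2 : NNReal) : ENNReal)).map s

theorem measurable_normSq (f : L2R) : Measurable fun x => (‖f x‖₊ ^ 2 : NNReal) :=
  (Lp.stronglyMeasurable f).measurable.nnnorm.pow_const 2

section MulModel

variable {s : ℝ → ℝ}

theorem memLp_mulMeasure_iff (hs : Measurable s) (f : L2R) {φ : ℝ → ℂ} (hφ : Measurable φ) :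
    MemLp φ 2 (mulMeasure s f) ↔ MemLp (fun x => φ (s x) * f x) 2 volume := by
  have hf := (Lp.stronglyMeasurable f).measurable
  have h1 : eLpNorm φ 2 (mulMeasure s f) = eLpNorm (fun x => φ (s x) * f x) 2 volume := by
    rw [eLpNorm_eq_lintegral_rpow_enorm_toReal (by norm_num) (by norm_num),
      eLpNorm_eq_lintegral_rpow_enorm_toReal (by norm_num) (by norm_num), mulMeasure,
      lintegral_map (by fun_prop) hs,
      lintegral_withDensity_eq_lintegral_mul _ (measurable_normSq f).coe_nnreal_ennreal
        (by fun_prop)]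
    congr 1
    apply lintegral_congr
    intro x
    simp [mul_pow, mul_comm]
    rfl
  rw [MemLp, MemLp, h1]
  exact and_congr_left fun _ => iff_of_true hφ.aestronglyMeasurable
    ((hφ.comp hs).mul hf).aestronglyMeasurable

theorem integral_mulMeasure (hs : Measurable s) (f : L2R) {φ : ℝ → ℂ} (hφ : Measurable φ)
    {g : L2R} (hg : g =ᵐ[volume] fun x => φ (s x) * f x) :
    ∫ x, φ x ∂(mulMeasure s f) = inner ℂ f g := by
  rw [inner_eq_integral_of_ae hg, mulMeasure, integral_map hs.aemeasurable
    hφ.aestronglyMeasurable, integral_withDensity_eq_integral_smul (measurable_normSq f)]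
  refine integral_congr_ae (Eventually.of_forall fun x => ?_)
  simp only
  rw [← Complex.normSq_eq_conj_mul_self, Complex.normSq_eq_norm_sq, NNReal.smul_def,
    Complex.real_smul, mul_comm]
  simp

/-- The indicator function of `{s ≤ x}`. -/
def sublevelInd (s : ℝ → ℝ) (x : ℝ) (ξ : ℝ) : ℂ := if s ξ ≤ x then 1 else 0

theorem memLp_sublevelInd (hs : Measurable s) (x : ℝ) :
    MemLp (sublevelInd s x) ⊤ (volume : Measure ℝ) := by
  refine memLp_top_of_bound (Measurable.aestronglyMeasurable ?_) 1 (Eventually.of_forall ?_)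
  · exact Measurable.ite (measurableSet_le hs measurable_const) measurable_const measurable_const
  · intro ξ
    unfold sublevelInd
    split_ifs <;> simp

theorem mulMeasure_Iic (hs : Measurable s) (f : L2R) (x : ℝ) :
    mulMeasure s f (Iic x) = ENNReal.ofReal (‖lpMul (memLp_sublevelInd hs x) f‖ ^ 2) := by
  have hm : MeasurableSet (s ⁻¹' Iic x) := hs measurableSet_Iic
  rw [L2R.ofReal_norm_sq, mulMeasure, Measure.map_apply hs measurableSet_Iic,
    withDensity_apply _ hm, ← lintegral_indicator hm]
  apply lintegral_congr_ae
  filter_upwards [coeFn_lpMul (memLp_sublevelInd hs x) f] with ξ hξ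
  rw [hξ, sublevelInd]
  by_cases h : s ξ ≤ x
  · rw [indicator_of_mem (by exact h), if_pos h, one_mul]
    simp
    rfl
  · rw [indicator_of_notMem (by exact h), if_neg h]
    simp

/-! ### The spectral resolution of a multiplication operator -/

variable {H : Type*} [NormedAddCommGroup H] [InnerProductSpace ℂ H]

/-- The operator on `H` corresponding to multiplication by `m` under a unitary map onto `L²`. -/
def conjMul (F : H ≃ₗᵢ[ℂ] L2R) {m : ℝ → ℂ} (hm : MemLp m ⊤ (volume : Measure ℝ)) : H →L[ℂ] H :=
  (F.symm : L2R →L[ℂ] H) ∘L lpMul hm ∘L (F : H →L[ℂ] L2R)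

theorem apply_conjMul (F : H ≃ₗᵢ[ℂ] L2R) {m : ℝ → ℂ} (hm : MemLp m ⊤ (volume : Measure ℝ))
    (u : H) : F (conjMul F hm u) = lpMul hm (F u) := by
  simp [conjMul]

theorem coeFn_conjMul (F : H ≃ₗᵢ[ℂ] L2R) {m : ℝ → ℂ} (hm : MemLp m ⊤ (volume : Measure ℝ))
    (u : H) : F (conjMul F hm u) =ᵐ[volume] fun x => m x * F u x := by
  rw [apply_conjMul]; exact coeFn_lpMul hm _

theorem eq_conjMul (F : H ≃ₗᵢ[ℂ] L2R) {m : ℝ → ℂ} (hm : MemLp m ⊤ (volume : Measure ℝ))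
    {u v : H} (h : F v =ᵐ[volume] fun x => m x * F u x) : conjMul F hm u = v := by
  apply F.injective
  exact Lp.ext ((coeFn_conjMul F hm u).trans h.symm)

/-- One statement serves right continuity and both limits at infinity: in each case the indicator,
at a fixed $\xi$, is eventually constant along the filter. -/
theorem tendsto_conjMul_sublevelInd (F : H ≃ₗᵢ[ℂ] L2R) (hs : Measurable s) {l : Filter ℝ}
    [l.IsCountablyGenerated] {m₀ : ℝ → ℂ} (hm₀ : MemLp m₀ ⊤ (volume : Measure ℝ))
    (h1 : ∀ ξ, ‖m₀ ξ‖ ≤ 1) (hlim : ∀ ξ, ∀ᶠ x in l, sublevelInd s x ξ = m₀ ξ) (u : H) :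
    Tendsto (fun x => conjMul F (memLp_sublevelInd hs x) u) l (𝓝 (conjMul F hm₀ u)) := by
  have h2 := tendsto_lpMul (l := l) (fun x => memLp_sublevelInd hs x) hm₀ (C := 2) ?_
    (fun ξ => tendsto_const_nhds.congr' ((hlim ξ).mono fun _ h => h.symm)) (F u)
  · exact (F.symm.continuous.tendsto _).comp h2
  · intro x ξ
    refine (norm_sub_le _ _).trans ?_
    have : ‖sublevelInd s x ξ‖ ≤ 1 := by unfold sublevelInd; split_ifs <;> simp
    linarith [h1 ξ]

variable [CompleteSpace H]

/-- The spectral resolution of the operator of multiplication by the real function `s`,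
transported by a unitary map. -/
def mulResolution (F : H ≃ₗᵢ[ℂ] L2R) (hs : Measurable s) : ResolutionOfIdentity H where
  proj x := conjMul F (memLp_sublevelInd hs x)
  isStarProjection x := by
    constructor
    · ext u
      refine (eq_conjMul F _ ?_)
      filter_upwards [coeFn_conjMul F (memLp_sublevelInd hs x) u] with ξ hξ
      simp only [sublevelInd] at hξ ⊢
      split_ifs at hξ ⊢ <;> simp [hξ]
    · rw [ContinuousLinearMap.isSelfAdjoint_iff_isSymmetric]
      intro u v
      change inner ℂ (conjMul F _ u) v = inner ℂ u (conjMul F _ v)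
      rw [← F.inner_map_map, ← F.inner_map_map u, L2.inner_def, L2.inner_def]
      apply integral_congr_ae
      filter_upwards [coeFn_conjMul F (memLp_sublevelInd hs x) u,
        coeFn_conjMul F (memLp_sublevelInd hs x) v] with ξ h1 h2
      rw [h1, h2, sublevelInd]
      split_ifs <;> simp
  proj_mul_proj x y := by
    ext u
    refine (eq_conjMul F _ ?_)
    filter_upwards [coeFn_conjMul F (memLp_sublevelInd hs y) u,
      coeFn_conjMul F (memLp_sublevelInd hs (min x y)) u] with ξ h1 h2
    refine h2.trans ?_
    change _ = _ * F (conjMul F _ u) ξ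
    rw [h1]
    simp only [sublevelInd, le_min_iff]
    split_ifs <;> simp_all
  right_continuous u x := by
    refine tendsto_conjMul_sublevelInd F hs (memLp_sublevelInd hs x) ?_ ?_ u
    · intro ξ
      unfold sublevelInd
      split_ifs <;> simp
    · intro ξ
      rcases le_or_gt (s ξ) x with h | h
      · filter_upwards [self_mem_nhdsWithin] with y hy
        simp [sublevelInd, h, h.trans hy]
      · filter_upwards [mem_nhdsWithin_of_mem_nhds (Iio_mem_nhds h)] with y hy
        simp [sublevelInd, not_le.2 h, not_le.2 (mem_Iio.1 hy)]
  tendsto_atBot u := by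
    have h0 : conjMul F (m := 0) MemLp.zero u = 0 := eq_conjMul F _ <| by
      rw [map_zero]
      filter_upwards [Lp.coeFn_zero ℂ 2 (volume : Measure ℝ)] with ξ hξ
      simp
    rw [← h0]
    refine tendsto_conjMul_sublevelInd F hs MemLp.zero (by simp) (fun ξ => ?_) u
    filter_upwards [Iio_mem_atBot (s ξ)] with y hy
    simp [sublevelInd, not_le.2 (mem_Iio.1 hy)]
  tendsto_atTop u := by
    have h1 : MemLp (1 : ℝ → ℂ) ⊤ (volume : Measure ℝ) := memLp_top_const 1
    have h0 : conjMul F h1 u = u := eq_conjMul F _ (by simp)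
    nth_rewrite 2 [← h0]
    refine tendsto_conjMul_sublevelInd F hs h1 (by simp) (fun ξ => ?_) u
    filter_upwards [Ici_mem_atTop (s ξ)] with y hy
    have : s ξ ≤ y := hy
    simp [sublevelInd, this]

theorem measure_mulResolution (F : H ≃ₗᵢ[ℂ] L2R) (hs : Measurable s) (u : H) :
    (mulResolution F hs).measure u = mulMeasure s (F u) := by
  refine Measure.ext_of_Iic _ _ fun x => ?_
  rw [ResolutionOfIdentity.measure_Iic, mulMeasure_Iic hs, ← apply_conjMul, F.norm_map]
  rfl

/-- `A` corresponds to multiplication by `s` under the unitary map `F`. -/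
def IsMulModel (F : H ≃ₗᵢ[ℂ] L2R) (s : ℝ → ℝ) (φ : ℝ → ℂ) (A : H →ₗ.[ℂ] H) : Prop :=
  (∀ u : H, MemLp (fun x => φ (s x) * F u x) 2 volume → u ∈ A.domain) ∧
    ∀ u : A.domain, F (A u) =ᵐ[volume] fun x => φ (s x) * F (u : H) x

/-- `IsMulModel` asks for one domain inclusion only; the other is automatic, since $F(Au)$ lies in
$L^2$. -/
theorem IsMulModel.isSpectralIntegral {F : H ≃ₗᵢ[ℂ] L2R} (hs : Measurable s) {φ : ℝ → ℂ}
    (hφ : Measurable φ) {A : H →ₗ.[ℂ] H} (hA : IsMulModel F s φ A) :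
    (mulResolution F hs).IsSpectralIntegral φ A := by
  refine ⟨fun u => ?_, fun u => ?_⟩
  · rw [measure_mulResolution, memLp_mulMeasure_iff hs _ hφ]
    exact ⟨fun hu => (memLp_congr_ae (hA.2 ⟨u, hu⟩)).1 (Lp.memLp _), hA.1 u⟩
  · rw [measure_mulResolution, integral_mulMeasure hs _ hφ (hA.2 u), F.inner_map_map]

/-! ### Uniqueness of the spectral resolution -/

/-- For $\rho>r$, on $\{|\sigma|\ge\rho\}$ one has $|f|\le\rho^{-n}|v_n|$, so the $L^2$ norm of $f$
there is at most $(r/\rho)^nC\to0$. Countably many $\rho=r+1/(k+1)$ exhaust $\{|\sigma|>r\}$. -/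
theorem ae_eq_zero_of_norm_le_pow {f : L2R} {σ : ℝ → ℝ} (hσ : Measurable σ) {r : ℝ}
    (v : ℕ → L2R) (hv : ∀ n, v n =ᵐ[volume] fun x => (σ x : ℂ) ^ n * f x) {C : ℝ}
    (hr : ∀ n, ‖v n‖ ≤ r ^ n * C) (hr0 : 0 ≤ r) :
    ∀ᵐ x, r < |σ x| → f x = 0 := by
  have key : ∀ ρ, r < ρ → ∀ᵐ x, ρ ≤ |σ x| → f x = 0 := by
    intro ρ hρ
    have hρ0 : 0 < ρ := hr0.trans_lt hρ
    have hS : MeasurableSet {x | ρ ≤ |σ x|} :=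
      measurableSet_le measurable_const (measurable_abs.comp hσ)
    have h1 : ∀ n : ℕ, ∫⁻ x in {x | ρ ≤ |σ x|}, ‖f x‖ₑ ^ 2 ≤
        ENNReal.ofReal (((r / ρ) ^ n * C) ^ 2) := by
      intro n
      have h2 : ‖((ρ ^ n : ℝ) : ℂ)⁻¹ • v n‖ ≤ (r / ρ) ^ n * C := by
        rw [norm_smul, norm_inv, Complex.norm_real, Real.norm_of_nonneg (by positivity), div_pow,
          inv_mul_le_iff₀ (by positivity)]
        refine (hr n).trans_eq ?_
        field_simp
      calc ∫⁻ x in {x | ρ ≤ |σ x|}, ‖f x‖ₑ ^ 2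
          ≤ ∫⁻ x in {x | ρ ≤ |σ x|}, ‖(((ρ ^ n : ℝ) : ℂ)⁻¹ • v n : L2R) x‖ₑ ^ 2 := by
            apply lintegral_mono_ae
            filter_upwards [ae_restrict_mem hS, ae_restrict_of_ae (hv n),
              ae_restrict_of_ae (Lp.coeFn_smul (((ρ ^ n : ℝ) : ℂ)⁻¹) (v n))] with x hx h3 h4
            gcongr
            rw [enorm_le_iff_norm_le, h4, Pi.smul_apply, h3, norm_smul, norm_mul, norm_inv,
              norm_pow, Complex.norm_real, Complex.norm_real, Real.norm_of_nonneg (by positivity),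
              Real.norm_eq_abs, ← mul_assoc]
            refine le_mul_of_one_le_left (norm_nonneg _) ?_
            rw [le_inv_mul_iff₀ (by positivity), mul_one]
            exact pow_le_pow_left₀ hρ0.le hx n
        _ ≤ ∫⁻ x, ‖(((ρ ^ n : ℝ) : ℂ)⁻¹ • v n : L2R) x‖ₑ ^ 2 := setLIntegral_le_lintegral _ _
        _ = ENNReal.ofReal (‖((ρ ^ n : ℝ) : ℂ)⁻¹ • v n‖ ^ 2) := (L2R.ofReal_norm_sq _).symm
        _ ≤ _ := by gcongr
    have h2 : Tendsto (fun n : ℕ => ENNReal.ofReal (((r / ρ) ^ n * C) ^ 2)) atTop (𝓝 0) := by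
      have := (((tendsto_pow_atTop_nhds_zero_of_lt_one (r := r / ρ) (by positivity)
        ((div_lt_one hρ0).2 hρ)).mul_const C).pow 2)
      simpa using ENNReal.tendsto_ofReal this
    have h3 : ∫⁻ x in {x | ρ ≤ |σ x|}, ‖f x‖ₑ ^ 2 = 0 :=
      le_antisymm (ge_of_tendsto' h2 h1) bot_le
    rw [lintegral_eq_zero_iff ((Lp.stronglyMeasurable f).measurable.enorm.pow_const 2)] at h3
    filter_upwards [(ae_restrict_iff' hS).1 h3] with x hx h
    simpa using hx h
  have h := ae_all_iff.2 fun k : ℕ => key (r + 1 / (k + 1)) (by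
    have : (0 : ℝ) < 1 / (k + 1) := by positivity
    linarith)
  filter_upwards [h] with x hx hlt
  obtain ⟨k, hk⟩ := exists_nat_one_div_lt (sub_pos.2 hlt)
  exact hx k (by linarith)

theorem IsMulModel.eq_mulResolution {F : H ≃ₗᵢ[ℂ] L2R} (hs : Measurable s)
    {A : H →ₗ.[ℂ] H} (hA : IsMulModel F s (fun x => (x : ℂ)) A) {E : ResolutionOfIdentity H}
    (hE : E.IsSpectralResolution A) : E = mulResolution F hs := by
  have hsymm : ∀ u v : A.domain, inner ℂ (A u) (v : H) = inner ℂ (u : H) (A v) := by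
    intro u v
    rw [← F.inner_map_map, ← F.inner_map_map (u : H), L2.inner_def, L2.inner_def]
    apply integral_congr_ae
    filter_upwards [hA.2 u, hA.2 v] with ξ h1 h2
    rw [h1, h2, RCLike.inner_apply', RCLike.inner_apply', map_mul, Complex.conj_ofReal]
    ring
  -- The powers of $A-(a+b)/2$ on the spectral subspace are multiplications by powers of $s-(a+b)/2$
  -- and grow at most like $((b-a)/2)^n$. The interval obtained is closed at $a$, so the comparison
  -- below needs $x<a$ strictly.
  have hsupp : ∀ a b : ℝ, a ≤ b → ∀ u : H, E.proj b u - E.proj a u = u →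
      ∀ᵐ ξ, (F u ξ ≠ 0 → s ξ ∈ Icc a b) := by
    intro a b hab u hu
    let T := hE.restrict hab ((a + b) / 2 : ℝ)
    let u₀ : E.spectralSubspace a b := ⟨u, hu⟩
    have hv : ∀ n : ℕ, F ((T ^ n) u₀ : E.spectralSubspace a b) =ᵐ[volume]
        fun ξ => ((s ξ - (a + b) / 2 : ℝ) : ℂ) ^ n * F u ξ := by
      intro n
      induction n with
      | zero => simp; rfl
      | succ n ih =>
        rw [pow_succ', Module.End.mul_apply]
        set w := (T ^ n) u₀
        have hw := hA.2 ⟨w, hE.mem_domain hab w.2⟩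
        have hTw : (T w : H) = A ⟨w, hE.mem_domain hab w.2⟩ - (((a + b) / 2 : ℝ) : ℂ) • (w : H) :=
          rfl
        rw [hTw, map_sub, map_smul]
        filter_upwards [hw, ih, Lp.coeFn_sub (F (A ⟨w, hE.mem_domain hab w.2⟩))
          ((((a + b) / 2 : ℝ) : ℂ) • F (w : H)),
          Lp.coeFn_smul (((a + b) / 2 : ℝ) : ℂ) (F (w : H))] with ξ h1 h2 h3 h4
        rw [h3, Pi.sub_apply, h4, Pi.smul_apply, h1, h2]
        push_cast
        simp only [smul_eq_mul]
        ring
    have hb : ∀ n : ℕ, ‖F ((T ^ n) u₀ : E.spectralSubspace a b)‖ ≤ ((b - a) / 2) ^ n * ‖u‖ := by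
      intro n
      rw [F.norm_map]
      induction n with
      | zero => simp [u₀]
      | succ n ih =>
        rw [pow_succ', pow_succ', Module.End.mul_apply, mul_assoc]
        exact (hE.norm_restrict_le hab hsymm _).trans
          (mul_le_mul_of_nonneg_left ih (by linarith))
    filter_upwards [ae_eq_zero_of_norm_le_pow (by fun_prop) _ hv hb (by linarith)] with ξ hξ hne
    have h1 : |s ξ - (a + b) / 2| ≤ (b - a) / 2 := by
      by_contra! h
      exact hne (hξ h)
    rw [abs_le] at h1
    constructor <;> linarith [h1.1, h1.2]
  set E₀ := mulResolution F hs
  have hone : ∀ a b : ℝ, a ≤ b → ∀ u : H,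
      E₀.proj b (E.proj b u - E.proj a u) = E.proj b u - E.proj a u := by
    intro a b hab u
    refine eq_conjMul F (memLp_sublevelInd hs b) ?_
    filter_upwards [hsupp a b hab _ (ResolutionOfIdentity.sub_proj_idem hab u)] with ξ hξ
    by_cases h : F (E.proj b u - E.proj a u) ξ = 0
    · rw [h, mul_zero]
    · simp [sublevelInd, (hξ h).2]
  have hzero : ∀ x a b : ℝ, x < a → a ≤ b → ∀ u : H,
      E₀.proj x (E.proj b u - E.proj a u) = 0 := by
    intro x a b hx hab u
    refine eq_conjMul F (memLp_sublevelInd hs x) ?_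
    filter_upwards [hsupp a b hab _ (ResolutionOfIdentity.sub_proj_idem hab u),
      Lp.coeFn_zero ℂ 2 (volume : Measure ℝ)] with ξ hξ h0
    rw [map_zero, h0]
    by_cases h : F (E.proj b u - E.proj a u) ξ = 0
    · rw [h, mul_zero, Pi.zero_apply]
    · simp [sublevelInd, not_le.2 (hx.trans_le (hξ h).1)]
  have h1 : ∀ x u, E₀.proj x (E.proj x u) = E.proj x u := by
    intro x u
    have hl : Tendsto (fun a => E.proj x u - E.proj a u) atBot (𝓝 (E.proj x u)) := by
      simpa using tendsto_const_nhds.sub (E.tendsto_atBot u)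
    refine tendsto_nhds_unique (((E₀.proj x).continuous.tendsto _).comp hl) (hl.congr' ?_)
    filter_upwards [Iic_mem_atBot x] with a ha
    exact (hone a x ha u).symm
  have h2 : ∀ x a u, x < a → E₀.proj x (E.proj a u) = E₀.proj x u := by
    intro x a u hx
    have hl : Tendsto (fun b => E.proj b u - E.proj a u) atTop (𝓝 (u - E.proj a u)) :=
      (E.tendsto_atTop u).sub tendsto_const_nhds
    have h3 : E₀.proj x (u - E.proj a u) = 0 := by
      refine tendsto_nhds_unique (((E₀.proj x).continuous.tendsto _).comp hl)
        (tendsto_const_nhds.congr' ?_)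
      filter_upwards [Ici_mem_atTop a] with b hb
      exact (hzero x a b hx hb u).symm
    rw [map_sub, sub_eq_zero] at h3
    exact h3.symm
  apply ResolutionOfIdentity.ext
  ext x u
  -- Right continuity closes the gap between $x<a$ and $x$: as $a\downarrow x$, `h2` becomes
  -- $E^0_xE_xu=E^0_xu$, where $E^0$ is `E₀`, and by `h1` the left side is $E_xu$.
  have hl : Tendsto (fun a => E.proj a u) (𝓝[>] x) (𝓝 (E.proj x u)) :=
    (E.right_continuous u x).mono_left (nhdsWithin_mono _ Ioi_subset_Ici_self)
  rw [← h1]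
  refine tendsto_nhds_unique (((E₀.proj x).continuous.tendsto _).comp hl)
    (tendsto_const_nhds.congr' ?_)
  filter_upwards [self_mem_nhdsWithin] with a ha
  exact (h2 x a u ha).symm

end MulModel

open SchwartzMap FourierTransform

/-! ### Absolutely continuous primitives -/

theorem absolutelyContinuousOnInterval_integral_complex {g : ℝ → ℂ}
    (hg : LocallyIntegrable g volume) (c a b : ℝ) :
    AbsolutelyContinuousOnInterval (fun x => ∫ t in c..x, g t) a b := by
  have hi : ∀ x y : ℝ, IntervalIntegrable g volume x y := fun x y =>
    (hg.integrableOn_isCompact isCompact_uIcc).mono_set uIoc_subset_uIcc |>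
      intervalIntegrable_iff.2
  have hcst : ∀ (z : ℂ) (p q : ℝ), AbsolutelyContinuousOnInterval (fun _ : ℝ => z) p q :=
    fun z p q => (LipschitzWith.const z).lipschitzOnWith.absolutelyContinuousOnInterval
  have hre : ∀ p q, IntervalIntegrable (fun x => (g x).re) volume p q := fun p q =>
    ⟨(hi p q).1.re, (hi p q).2.re⟩
  have him : ∀ p q, IntervalIntegrable (fun x => (g x).im) volume p q := fun p q =>
    ⟨(hi p q).1.im, (hi p q).2.im⟩
  -- The base point $c$ may lie outside $[a,b]$, so absolute continuity is obtained on an interval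
  -- containing all three points and then restricted.
  set p := min c (min a b)
  set q := max c (max a b)
  have hpq : p ≤ q := (min_le_left _ _).trans (le_max_left _ _)
  have hc : c ∈ uIcc p q := by
    rw [uIcc_of_le hpq]; exact ⟨min_le_left _ _, le_max_left _ _⟩
  have hsub : uIcc a b ⊆ uIcc p q := by
    rw [uIcc_of_le hpq]
    exact Icc_subset_Icc (min_le_right _ _) (le_max_right _ _)
  have h1 := ((hre p q).absolutelyContinuousOnInterval_intervalIntegral hc).mono hsub
  have h2 := ((him p q).absolutelyContinuousOnInterval_intervalIntegral hc).mono hsub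
  have h3 := (h1.smul (hcst 1 a b)).add (h2.smul (hcst Complex.I a b))
  refine (congrArg (AbsolutelyContinuousOnInterval · a b) (funext fun x => ?_)).mpr h3
  simp only [Pi.add_apply, Pi.smul_apply', Complex.real_smul, mul_one]
  rw [← intervalIntegral.integral_ofReal, ← intervalIntegral.integral_ofReal,
    ← intervalIntegral.integral_mul_const, ← intervalIntegral.integral_add]
  · exact intervalIntegral.integral_congr fun t _ => (Complex.re_add_im (g t)).symm
  · exact ⟨(hre c x).1.ofReal, (hre c x).2.ofReal⟩
  · exact IntervalIntegrable.mul_const ⟨(him c x).1.ofReal, (him c x).2.ofReal⟩ _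

theorem L2R.locallyIntegrable (g : L2R) : LocallyIntegrable g volume :=
  (Lp.memLp g).locallyIntegrable (by norm_num)

/-- Up to sign, the integral is the inner product with the indicator of a bounded interval, hence
continuous on $L^2$. -/
theorem tendsto_intervalIntegral_L2R {ι : Type*} {l : Filter ι} {v : ι → L2R} {g : L2R}
    (h : Tendsto v l (𝓝 g)) (a b : ℝ) :
    Tendsto (fun n => ∫ t in a..b, v n t) l (𝓝 (∫ t in a..b, g t)) := by
  simp only [intervalIntegral.intervalIntegral_eq_integral_uIoc]
  refine Tendsto.const_smul ?_ _
  have hμ : volume (uIoc a b) ≠ ⊤ := by simp [uIoc]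
  simp only [← L2.inner_indicatorConstLp_one (𝕜 := ℂ) measurableSet_uIoc hμ]
  exact tendsto_const_nhds.inner h

/-- Along an almost everywhere convergent subsequence, with $a$ a point of convergence,
$\varphi(x)=\varphi(a)+\int_a^x\varphi'$ passes to the limit and exhibits an absolutely continuous
representative. -/
theorem mem_momentumGraph_of_tendsto {φ : ℕ → 𝓢(ℝ, ℂ)} {u h : L2R}
    (h1 : Tendsto (fun n => (φ n).toLp 2 volume) atTop (𝓝 u))
    (h2 : Tendsto (fun n => (derivCLM ℂ ℂ (φ n)).toLp 2 volume) atTop (𝓝 (Complex.I • h))) :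
    (u, h) ∈ momentumGraph := by
  obtain ⟨ns, hns, hae⟩ := (tendstoInMeasure_of_tendsto_Lp h1).exists_seq_tendsto_ae
  have hae' : ∀ᵐ x, Tendsto (fun i => φ (ns i) x) atTop (𝓝 (u x)) := by
    filter_upwards [hae, ae_all_iff.2 fun i => (φ (ns i)).coeFn_toLp 2 volume] with x hx hi
    simpa only [hi] using hx
  obtain ⟨a, ha⟩ := hae'.exists
  set g : L2R := Complex.I • h with hg
  have hloc := L2R.locallyIntegrable g
  refine ⟨fun x => u a + ∫ t in a..x, g t, ?_, fun p q => ?_, ?_⟩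
  · filter_upwards [hae'] with x hx
    refine tendsto_nhds_unique hx ?_
    have h3 := (tendsto_intervalIntegral_L2R (h2.comp hns.tendsto_atTop) a x)
    refine (ha.add h3).congr fun i => ?_
    have h4 : ∫ t in a..x, ((derivCLM ℂ ℂ (φ (ns i))).toLp 2 volume) t =
        ∫ t in a..x, deriv (φ (ns i)) t := by
      apply intervalIntegral.integral_congr_ae
      filter_upwards [(derivCLM ℂ ℂ (φ (ns i))).coeFn_toLp 2 volume] with t ht _
      rw [ht, derivCLM_apply]
    simp only [Function.comp_apply]
    rw [h4, intervalIntegral.integral_deriv_eq_sub (fun t _ => (φ (ns i)).differentiableAt)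
      ((derivCLM ℂ ℂ (φ (ns i))).continuous.intervalIntegrable a x)]
    ring
  · exact ((LipschitzWith.const (u a)).lipschitzOnWith.absolutelyContinuousOnInterval).add
      (absolutelyContinuousOnInterval_integral_complex hloc a p q)
  · filter_upwards [_root_.LocallyIntegrable.ae_hasDerivAt_integral hloc, Lp.coeFn_smul Complex.I h] with x hx hs
    have := (hx a).const_add (u a)
    rwa [hg, hs] at this

/-! ### The momentum operator in the Fourier representation -/

/-- The function `ξ ↦ (ξ - i)⁻¹`. -/
def resolventSymbol (ξ : ℝ) : ℂ := ((ξ : ℂ) + Complex.I) * (((1 + ‖ξ‖ ^ 2) ^ (-1 : ℝ) : ℝ) : ℂ)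

theorem resolventSymbol_mul (ξ : ℝ) : resolventSymbol ξ * ((ξ : ℂ) - Complex.I) = 1 := by
  have h : (1 + (ξ : ℂ) ^ 2) ≠ 0 := by
    have : (1 + ξ ^ 2) ≠ 0 := by positivity
    exact_mod_cast this
  rw [resolventSymbol, Real.rpow_neg_one, Real.norm_eq_abs, sq_abs]
  push_cast
  field_simp
  linear_combination -Complex.I_sq

theorem norm_resolventSymbol_le (ξ : ℝ) : ‖resolventSymbol ξ‖ ≤ 1 := by
  have h1 : 1 ≤ ‖(ξ : ℂ) - Complex.I‖ := by
    have := Complex.abs_im_le_norm ((ξ : ℂ) - Complex.I)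
    simpa using this
  have h2 := congrArg norm (resolventSymbol_mul ξ)
  rw [norm_mul, norm_one] at h2
  nlinarith [norm_nonneg (resolventSymbol ξ)]

theorem hasTemperateGrowth_resolventSymbol : resolventSymbol.HasTemperateGrowth := by
  unfold resolventSymbol
  fun_prop

theorem memLp_resolventSymbol : MemLp resolventSymbol ⊤ (volume : Measure ℝ) :=
  memLp_top_of_bound hasTemperateGrowth_resolventSymbol.1.continuous.aestronglyMeasurable 1
    (Eventually.of_forall norm_resolventSymbol_le)

/-- The Fourier transform on `L²(ℝ, ℂ)`. -/
abbrev fourierL2R : L2R ≃ₗᵢ[ℂ] L2R := Lp.fourierTransformₗᵢ ℝ ℂ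

theorem fourier_derivCLM_apply (φ : 𝓢(ℝ, ℂ)) (ξ : ℝ) :
    𝓕 (derivCLM ℂ ℂ φ) ξ = 2 * Real.pi * Complex.I * (ξ * 𝓕 φ ξ) := by
  have h1 : derivCLM ℂ ℂ φ = LineDeriv.lineDerivOp (1 : ℝ) φ := by
    ext x
    rw [derivCLM_apply, lineDerivOp_apply_eq_fderiv, fderiv_eq_smul_deriv, one_smul]
  rw [h1, fourier_lineDerivOp_eq, smul_apply, smulLeftCLM_apply_apply (by fun_prop)]
  simp

/-- The function $(\xi-i)Fu$ is in $L^2$. Approximating it by Schwartz functions $\varphi_n$ and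
dividing by $\xi-i$ gives Schwartz functions $\psi_n\to Fu$ for which $\xi\psi_n=\varphi_n+i\psi_n$
converges too. Thus their inverse transforms converge together with their derivatives. -/
theorem mem_momentumGraph_of_fourier {u h : L2R}
    (huh : fourierL2R h =ᵐ[volume] fun ξ => ((2 * Real.pi * ξ : ℝ) : ℂ) * fourierL2R u ξ) :
    (u, h) ∈ momentumGraph := by
  set c : ℂ := 2 * Real.pi with hc
  have hc0 : c ≠ 0 := by simp [hc, Real.pi_ne_zero]
  -- By `huh`, this is $(\xi-i)Fu$, written so that membership in $L^2$ is evident.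
  set w : L2R := c⁻¹ • fourierL2R h - Complex.I • fourierL2R u with hw
  have hwu : lpMul memLp_resolventSymbol w = fourierL2R u := by
    apply Lp.ext
    filter_upwards [coeFn_lpMul memLp_resolventSymbol w, huh,
      Lp.coeFn_sub (c⁻¹ • fourierL2R h) (Complex.I • fourierL2R u),
      Lp.coeFn_smul c⁻¹ (fourierL2R h), Lp.coeFn_smul Complex.I (fourierL2R u)]
      with ξ h1 h2 h3 h4 h5
    rw [h1, hw, h3, Pi.sub_apply, h4, h5, Pi.smul_apply, Pi.smul_apply, h2, smul_eq_mul,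
      smul_eq_mul]
    have : c⁻¹ * (((2 * Real.pi * ξ : ℝ) : ℂ) * fourierL2R u ξ) = ξ * fourierL2R u ξ := by
      push_cast
      rw [← hc]
      field_simp
    rw [this]
    linear_combination fourierL2R u ξ * resolventSymbol_mul ξ
  have hdense : w ∈ closure (range (toLpCLM ℝ (E := ℝ) ℂ 2 volume)) :=
    denseRange_toLpCLM ENNReal.ofNat_ne_top w
  obtain ⟨ω, hω, hlim⟩ := mem_closure_iff_seq_limit.1 hdense
  choose φ hφ using hω
  have hlimφ : Tendsto (fun n => (φ n).toLp 2 volume) atTop (𝓝 w) := hlim.congr fun n => (hφ n).symm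
  set ψ : ℕ → 𝓢(ℝ, ℂ) := fun n => smulLeftCLM ℂ resolventSymbol (φ n) with hψ
  have hψφ : ∀ n ξ, ψ n ξ = resolventSymbol ξ * φ n ξ := fun n ξ =>
    smulLeftCLM_apply_apply hasTemperateGrowth_resolventSymbol _ _
  have hψL : ∀ n, (ψ n).toLp 2 volume = lpMul memLp_resolventSymbol ((φ n).toLp 2 volume) := by
    intro n
    apply Lp.ext
    filter_upwards [(ψ n).coeFn_toLp 2 volume, (φ n).coeFn_toLp 2 volume,
      coeFn_lpMul memLp_resolventSymbol ((φ n).toLp 2 volume)] with ξ h1 h2 h3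
    rw [h1, h3, h2, hψφ]
  have hlimψ : Tendsto (fun n => (ψ n).toLp 2 volume) atTop (𝓝 (fourierL2R u)) := by
    simp only [hψL]
    rw [← hwu]
    exact ((lpMul memLp_resolventSymbol).continuous.tendsto _).comp hlimφ
  refine mem_momentumGraph_of_tendsto (φ := fun n => 𝓕⁻ (ψ n)) ?_ ?_
  · have h1 : ∀ n, (𝓕⁻ (ψ n)).toLp 2 volume = fourierL2R.symm ((ψ n).toLp 2 volume) := fun n =>
      (toLp_fourierInv_eq (ψ n)).symm
    simp only [h1]
    have := (fourierL2R.symm.continuous.tendsto _).comp hlimψ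
    rwa [LinearIsometryEquiv.symm_apply_apply] at this
  · have h1 : ∀ n, (derivCLM ℂ ℂ (𝓕⁻ (ψ n))).toLp 2 volume = fourierL2R.symm
        ((c * Complex.I) • ((φ n).toLp 2 volume + Complex.I • (ψ n).toLp 2 volume)) := by
      intro n
      rw [LinearIsometryEquiv.eq_symm_apply]
      have h2 : fourierL2R ((derivCLM ℂ ℂ (𝓕⁻ (ψ n))).toLp 2 volume) =
          (𝓕 (derivCLM ℂ ℂ (𝓕⁻ (ψ n)))).toLp 2 volume := toLp_fourier_eq _
      rw [h2]
      have h3 : 𝓕 (derivCLM ℂ ℂ (𝓕⁻ (ψ n))) = (c * Complex.I) • (φ n + Complex.I • ψ n) := by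
        ext ξ
        rw [fourier_derivCLM_apply, fourier_fourierInv_eq, smul_apply, add_apply, smul_apply,
          hψφ, smul_eq_mul, smul_eq_mul]
        linear_combination c * Complex.I * φ n ξ * resolventSymbol_mul ξ
      rw [h3]
      rfl
    simp only [h1]
    have h2 : fourierL2R.symm ((c * Complex.I) • (w + Complex.I • fourierL2R u)) =
        Complex.I • h := by
      rw [LinearIsometryEquiv.symm_apply_eq, hw, sub_add_cancel, smul_smul, map_smul]
      congr 1
      field_simp
    rw [← h2]
    exact (fourierL2R.symm.continuous.tendsto _).comp
      ((hlimφ.add (hlimψ.const_smul _)).const_smul _)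

/-- $P-ci$ is injective: the equation reads $F'=-cF$, so $F=F(0)e^{-cx}$, which is not square
integrable near $-\infty$ unless $F(0)=0$. -/
theorem eq_zero_of_mem_momentumGraph {d : L2R} {c : ℝ} (hc : 0 < c)
    (hd : (d, ((c : ℂ) * Complex.I) • d) ∈ momentumGraph) : d = 0 := by
  obtain ⟨F, hF, hFa, hFd⟩ := hd
  change d =ᵐ[volume] F at hF
  change ∀ᵐ x, HasDerivAt F (Complex.I * (((c : ℂ) * Complex.I) • d : L2R) x) x at hFd
  have hG : ∀ a b, AbsolutelyContinuousOnInterval (fun x => Real.exp (c * x) • F x) a b := by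
    intro a b
    have h1 : ContDiffOn ℝ 1 (fun x : ℝ => Real.exp (c * x)) (uIcc a b) := by fun_prop
    exact h1.absolutelyContinuousOnInterval.smul (hFa a b)
  have hGd : ∀ᵐ x, HasDerivAt (fun x => Real.exp (c * x) • F x) 0 x := by
    filter_upwards [hFd, hF, Lp.coeFn_smul ((c : ℂ) * Complex.I) d] with x h1 h2 h3
    rw [h3, Pi.smul_apply, h2, smul_eq_mul] at h1
    have h4 : HasDerivAt (fun x : ℝ => Real.exp (c * x)) (Real.exp (c * x) * c) x := by
      simpa using ((hasDerivAt_id x).const_mul c).exp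
    refine (h4.smul h1).congr_deriv ?_
    simp only [Complex.real_smul]
    push_cast
    linear_combination (Complex.exp (c * x) * c * F x) * Complex.I_mul_I
  have hconst : ∀ x, Real.exp (c * x) • F x = F 0 := by
    intro x
    obtain ⟨C, hC⟩ := (hG 0 x).const_of_ae_hasDerivAt_zero (hGd.mono fun _ h _ => h)
    rw [hC x right_mem_uIcc, ← hC 0 left_mem_uIcc]
    simp
  have hF0 : F 0 = 0 := by
    by_contra hne
    have hL : MemLp F 2 volume := (memLp_congr_ae hF).1 (Lp.memLp d)
    have hint := ((memLp_two_iff_integrable_sq_norm hL.1).1 hL).integrableOn (s := Iic 0)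
    have h1 : IntegrableOn (fun _ : ℝ => ‖F 0‖ ^ 2) (Iic 0) volume := by
      refine Integrable.mono' hint aestronglyMeasurable_const ?_
      filter_upwards [ae_restrict_mem measurableSet_Iic] with x hx
      rw [Real.norm_of_nonneg (by positivity), ← hconst x, norm_smul, Real.norm_eq_abs,
        Real.abs_exp]
      have h2 : Real.exp (c * x) ≤ 1 :=
        Real.exp_le_one_iff.2 (mul_nonpos_of_nonneg_of_nonpos hc.le hx)
      gcongr
      exact mul_le_of_le_one_left (norm_nonneg _) h2
    rw [integrableOn_const_iff] at h1
    rcases h1 with h1 | h1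
    · simp [hne] at h1
    · simp at h1
  apply Lp.ext
  filter_upwards [hF, Lp.coeFn_zero ℂ 2 (volume : Measure ℝ)] with x h1 h2
  have h3 := hconst x
  rw [hF0, smul_eq_zero] at h3
  rw [h1, h2, h3.resolve_left (Real.exp_ne_zero _)]
  rfl

/-- $P$ extends the multiplication operator by `mem_momentumGraph_of_fourier`, and equality follows
by a resolvent argument. Multiplication by $2\pi(\xi-i)$ is onto, so some $u'$ in the smaller domain
satisfies $(P-2\pi i)u'=(P-2\pi i)u$; injectivity of $P-2\pi i$ gives $u'=u$. -/
theorem fourier_of_mem_momentumGraph {u h : L2R} (huh : (u, h) ∈ momentumGraph) :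
    fourierL2R h =ᵐ[volume] fun ξ => ((2 * Real.pi * ξ : ℝ) : ℂ) * fourierL2R u ξ := by
  set c : ℂ := ((2 * Real.pi : ℝ) : ℂ) with hc
  have hc0 : c ≠ 0 := by simp [hc, Real.pi_ne_zero]
  set w : L2R := fourierL2R (h - (c * Complex.I) • u) with hw
  set v : L2R := lpMul memLp_resolventSymbol (c⁻¹ • w) with hv
  set u' : L2R := fourierL2R.symm v with hu'
  set h' : L2R := h - (c * Complex.I) • u + (c * Complex.I) • u' with hh'
  have hFu' : fourierL2R u' = v := LinearIsometryEquiv.apply_symm_apply _ _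
  have key : fourierL2R h' =ᵐ[volume]
      fun ξ => ((2 * Real.pi * ξ : ℝ) : ℂ) * fourierL2R u' ξ := by
    have h0 : fourierL2R h' = w + (c * Complex.I) • v := by
      rw [hh', map_add, map_smul, hFu']
    rw [h0, hFu']
    filter_upwards [Lp.coeFn_add w ((c * Complex.I) • v), Lp.coeFn_smul (c * Complex.I) v,
      Lp.coeFn_smul c⁻¹ w, coeFn_lpMul memLp_resolventSymbol (c⁻¹ • w)] with ξ h1 h2 h3 h4
    have h5 : v ξ = resolventSymbol ξ * (c⁻¹ * w ξ) := by
      rw [hv, h4, h3]; rfl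
    have h6 : w ξ = c * (ξ - Complex.I) * v ξ := by
      rw [h5]
      have : c * c⁻¹ = 1 := mul_inv_cancel₀ hc0
      linear_combination (-(w ξ)) * this - (c * c⁻¹ * w ξ) * resolventSymbol_mul ξ
    rw [h1, Pi.add_apply, h2, Pi.smul_apply, h6, smul_eq_mul, Complex.ofReal_mul (2 * Real.pi) ξ,
      ← hc]
    ring
  have hdiff := momentumGraph.sub_mem huh (mem_momentumGraph_of_fourier key)
  have heq : (u, h) - (u', h') = (u - u', (c * Complex.I) • (u - u')) := by
    rw [Prod.mk_sub_mk, hh', smul_sub]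
    congr 1
    abel
  rw [heq] at hdiff
  have hd := sub_eq_zero.1 (eq_zero_of_mem_momentumGraph (by positivity) hdiff)
  have hhh : h' = h := by rw [hh', ← hd, sub_add_cancel]
  rwa [← hd, hhh] at key

theorem isMulModel_momentum :
    IsMulModel fourierL2R (fun ξ => 2 * Real.pi * ξ) (fun x => (x : ℂ)) momentum := by
  refine ⟨fun u hu => ?_, fun u => ?_⟩
  · refine LinearPMap.mem_domain_of_mem_graph (y := fourierL2R.symm (hu.toLp _)) ?_
    rw [momentum_graph]
    apply mem_momentumGraph_of_fourier
    rw [LinearIsometryEquiv.apply_symm_apply]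
    exact hu.coeFn_toLp
  · apply fourier_of_mem_momentumGraph
    rw [← momentum_graph]
    exact LinearPMap.mem_graph _ u

/-! ### The Fourier transform of the vacuum vector -/

/-- Both sides are compared as tempered distributions, where the claim reduces to moving the Fourier
integral from a Schwartz test function onto $f$. -/
theorem fourierL2R_toLp {f : ℝ → ℂ} (h1 : Integrable f) (h2 : MemLp f 2 volume)
    (h3 : MemLp (𝓕 f) 2 volume) : fourierL2R (h2.toLp f) = h3.toLp (𝓕 f) := by
  have hinj := LinearMap.ker_eq_bot.1
    (Lp.ker_toTemperedDistributionCLM_eq_bot (F := ℂ) (μ := (volume : Measure ℝ)) (p := 2))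
  apply hinj
  have h4 : Lp.toTemperedDistribution (fourierL2R (h2.toLp f)) =
      𝓕 (Lp.toTemperedDistribution (h2.toLp f)) :=
    (Lp.fourier_toTemperedDistribution_eq _).symm
  change Lp.toTemperedDistribution _ = Lp.toTemperedDistribution _
  rw [h4]
  ext g
  rw [TemperedDistribution.fourier_apply, Lp.toTemperedDistribution_apply,
    Lp.toTemperedDistribution_apply]
  have h5 : ∫ x, 𝓕 g x • h2.toLp f x = ∫ x, 𝓕 g x • f x := by
    apply integral_congr_ae
    filter_upwards [h2.coeFn_toLp] with x hx
    rw [hx]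
  have h6 : ∫ x, g x • h3.toLp (𝓕 f) x = ∫ x, g x • 𝓕 f x := by
    apply integral_congr_ae
    filter_upwards [h3.coeFn_toLp] with x hx
    rw [hx]
  rw [h5, h6]
  have h7 := VectorFourier.integral_fourierIntegral_smul_eq_flip (L := innerₗ ℝ)
    Real.continuous_fourierChar continuous_inner (g.integrable (μ := volume)) h1
  rw [flip_innerₗ] at h7
  exact h7

/-- The Fourier transform of the vacuum vector. -/
def vacuumFourier (ξ : ℝ) : ℂ :=
  ((Real.pi ^ (-(1 / 4) : ℝ) * (√(2 * Real.pi) * Real.exp (-(2 * Real.pi * ξ) ^ 2 / 2)) : ℝ) : ℂ)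

theorem fourier_vacuumFun : 𝓕 vacuumFun = vacuumFourier := by
  have hπ := Real.pi_pos
  -- The parameter $1/(2\pi)$ makes $-\pi bx^2$ equal to $-x^2/2$.
  have h1 : vacuumFun = fun x : ℝ => ((Real.pi ^ (-(1 / 4) : ℝ) : ℝ) : ℂ) •
      Complex.exp (-Real.pi * ((1 / (2 * Real.pi) : ℝ) : ℂ) * x ^ 2) := by
    funext x
    rw [vacuumFun, Complex.ofReal_mul, Complex.ofReal_exp, smul_eq_mul]
    congr 2
    have : (Real.pi : ℂ) ≠ 0 := by exact_mod_cast hπ.ne'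
    push_cast
    field_simp
  have h2 : 𝓕 vacuumFun = ((Real.pi ^ (-(1 / 4) : ℝ) : ℝ) : ℂ) •
      𝓕 (fun x : ℝ => Complex.exp (-Real.pi * ((1 / (2 * Real.pi) : ℝ) : ℂ) * x ^ 2)) := by
    rw [h1]
    funext ξ
    simp only [Pi.smul_apply, Real.fourier_real_eq_integral_exp_smul, ← integral_smul]
    exact integral_congr_ae (Eventually.of_forall fun x => smul_comm _ _ _)
  rw [h2, fourier_gaussian_pi (by rw [Complex.ofReal_re]; positivity)]
  funext ξ
  rw [Pi.smul_apply, smul_eq_mul, vacuumFourier, Complex.ofReal_mul, Complex.ofReal_mul,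
    Complex.ofReal_exp]
  have h3 : (1 : ℂ) / ((1 / (2 * Real.pi) : ℝ) : ℂ) ^ (1 / 2 : ℂ) = ((√(2 * Real.pi) : ℝ) : ℂ) := by
    have : ((1 / (2 * Real.pi) : ℝ) : ℂ) ^ (1 / 2 : ℂ) =
        (((1 / (2 * Real.pi)) ^ (1 / 2 : ℝ) : ℝ) : ℂ) := by
      rw [Complex.ofReal_cpow (by positivity)]
      norm_num
    rw [this, ← Real.sqrt_eq_rpow, one_div, one_div, Real.sqrt_inv, ← Complex.ofReal_inv, inv_inv]
  rw [h3]
  congr 3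
  have : (Real.pi : ℂ) ≠ 0 := by exact_mod_cast hπ.ne'
  push_cast
  field_simp

theorem integrable_vacuumFun : Integrable vacuumFun := by
  have h := (integrable_exp_neg_mul_sq (b := 1 / 2) (by norm_num)).const_mul
    (Real.pi ^ (-(1 / 4) : ℝ))
  have h' : Integrable fun x : ℝ => Real.pi ^ (-(1 / 4) : ℝ) * Real.exp (-x ^ 2 / 2) :=
    h.congr (Eventually.of_forall fun x => by ring_nf)
  exact h'.ofReal

theorem memLp_vacuumFourier : MemLp vacuumFourier 2 (volume : Measure ℝ) := by
  have hc : Continuous vacuumFourier := by unfold vacuumFourier; fun_prop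
  rw [memLp_two_iff_integrable_sq_norm hc.aestronglyMeasurable]
  have h := (integrable_exp_neg_mul_sq (b := (2 * Real.pi) ^ 2) (by positivity)).const_mul
    ((Real.pi ^ (-(1 / 4) : ℝ)) ^ 2 * √(2 * Real.pi) ^ 2)
  refine h.congr (Eventually.of_forall fun x => ?_)
  simp only [vacuumFourier, Complex.norm_real, Real.norm_eq_abs, sq_abs, mul_pow,
    ← Real.exp_nat_mul]
  rw [mul_assoc]
  congr 3
  push_cast
  ring

theorem fourierL2R_vacuum : fourierL2R vacuum =ᵐ[volume] vacuumFourier := by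
  have h3 : MemLp (𝓕 vacuumFun) 2 volume := by
    rw [fourier_vacuumFun]; exact memLp_vacuumFourier
  have := fourierL2R_toLp integrable_vacuumFun memLp_vacuumFun h3
  rw [vacuum, this]
  exact h3.coeFn_toLp.trans (by rw [fourier_vacuumFun])

theorem conj_vacuumFourier_mul_self (ξ : ℝ) : (starRingEnd ℂ) (vacuumFourier ξ) * vacuumFourier ξ =
    (2 * Real.pi * (Real.pi ^ (-(1 / 2) : ℝ) * Real.exp (-(2 * Real.pi * ξ) ^ 2)) : ℝ) := by
  have hπ := Real.pi_pos
  rw [vacuumFourier, Complex.conj_ofReal, ← Complex.ofReal_mul]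
  congr 1
  have h1 : Real.pi ^ (-(1 / 4) : ℝ) * Real.pi ^ (-(1 / 4) : ℝ) = Real.pi ^ (-(1 / 2) : ℝ) := by
    rw [← Real.rpow_add hπ]; norm_num
  have h2 : √(2 * Real.pi) * √(2 * Real.pi) = 2 * Real.pi := Real.mul_self_sqrt (by positivity)
  have h3 : Real.exp (-(2 * Real.pi * ξ) ^ 2 / 2) * Real.exp (-(2 * Real.pi * ξ) ^ 2 / 2) =
      Real.exp (-(2 * Real.pi * ξ) ^ 2) := by
    rw [← Real.exp_add]; ring_nf
  calc _ = (Real.pi ^ (-(1 / 4) : ℝ) * Real.pi ^ (-(1 / 4) : ℝ)) *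
        (√(2 * Real.pi) * √(2 * Real.pi)) * (Real.exp (-(2 * Real.pi * ξ) ^ 2 / 2) *
          Real.exp (-(2 * Real.pi * ξ) ^ 2 / 2)) := by ring
    _ = _ := by rw [h1, h2, h3]; ring

/-- Under $s=2\pi\xi$ the Jacobian cancels the factor $2\pi$ in $|F\Phi|^2$. Indicators $g$ give the
vacuum resolution, exponentials its characteristic function. -/
theorem inner_vacuum_conjMul (g : ℝ → ℂ)
    (hg : MemLp (fun ξ => g (2 * Real.pi * ξ)) ⊤ (volume : Measure ℝ)) :
    inner ℂ vacuum (conjMul fourierL2R hg vacuum) =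
      ((Real.pi ^ (-(1 / 2) : ℝ) : ℝ) : ℂ) * ∫ s : ℝ, g s * (Real.exp (-s ^ 2) : ℝ) := by
  have hπ := Real.pi_pos
  rw [← fourierL2R.inner_map_map, inner_eq_integral_of_ae (coeFn_conjMul fourierL2R hg vacuum)]
  have h1 : ∫ ξ, g (2 * Real.pi * ξ) *
        ((starRingEnd ℂ) (fourierL2R vacuum ξ) * fourierL2R vacuum ξ) =
      ∫ ξ : ℝ, (fun s : ℝ => ((2 * Real.pi * Real.pi ^ (-(1 / 2) : ℝ) : ℝ) : ℂ) *
        (g s * (Real.exp (-s ^ 2) : ℝ))) (2 * Real.pi * ξ) := by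
    apply integral_congr_ae
    filter_upwards [fourierL2R_vacuum] with ξ hξ
    rw [hξ, conj_vacuumFourier_mul_self]
    push_cast
    ring
  rw [h1, Measure.integral_comp_mul_left (fun s : ℝ =>
    ((2 * Real.pi * Real.pi ^ (-(1 / 2) : ℝ) : ℝ) : ℂ) * (g s * (Real.exp (-s ^ 2) : ℝ))), integral_const_mul, Complex.real_smul,
    abs_of_pos (by positivity), ← mul_assoc, ← Complex.ofReal_mul]
  congr 2
  field_simp

/-! ### The exponentials of the momentum operator -/

theorem memLp_exp (t : ℝ) :
    MemLp (fun ξ : ℝ => Complex.exp (Complex.I * t * ((2 * Real.pi * ξ : ℝ) : ℂ))) ⊤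
      (volume : Measure ℝ) := by
  refine memLp_top_of_bound (Continuous.aestronglyMeasurable (by fun_prop)) 1
    (Eventually.of_forall fun ξ => ?_)
  rw [mul_assoc, ← Complex.ofReal_mul, mul_comm, Complex.norm_exp_ofReal_mul_I]

theorem isMulModel_conjMul {H : Type*} [NormedAddCommGroup H] [InnerProductSpace ℂ H]
    (F : H ≃ₗᵢ[ℂ] L2R) {s : ℝ → ℝ} {φ : ℝ → ℂ}
    (hφ : MemLp (fun ξ => φ (s ξ)) ⊤ (volume : Measure ℝ)) :
    IsMulModel F s φ ((conjMul F hφ : H →ₗ[ℂ] H).toPMap ⊤) :=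
  ⟨fun _ _ => trivial, fun u => coeFn_conjMul F hφ u⟩

/-- Over $\mathbb C$ an operator with vanishing quadratic form is zero. -/
theorem ResolutionOfIdentity.IsExpI.unique {H : Type*} [NormedAddCommGroup H]
    [InnerProductSpace ℂ H] [CompleteSpace H] {E : ResolutionOfIdentity H} {t : ℝ}
    {U V : H →L[ℂ] H} (hU : E.IsExpI t U) (hV : E.IsExpI t V) : V = U := by
  have h : (V : H →ₗ[ℂ] H) = U := by
    rw [← sub_eq_zero, ← inner_map_self_eq_zero]
    intro u
    have h1 : inner ℂ u (U u) = inner ℂ u (V u) :=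
      (hU.2 ⟨u, trivial⟩).trans (hV.2 ⟨u, trivial⟩).symm
    have h2 : inner ℂ u ((V : H →ₗ[ℂ] H) u - (U : H →ₗ[ℂ] H) u) = 0 := by
      rw [inner_sub_right, sub_eq_zero]
      exact h1.symm
    rw [← inner_conj_symm, LinearMap.sub_apply, h2, map_zero]
  exact ContinuousLinearMap.coe_injective h

/-! ### The main theorem -/

theorem theoremP :
    ∃ E : ResolutionOfIdentity L2R,
      E.IsSpectralResolution momentum ∧
      (∀ E' : ResolutionOfIdentity L2R, E'.IsSpectralResolution momentum → E' = E) ∧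
      (∀ x : ℝ, inner ℂ vacuum (E.proj x vacuum) =
        ((Real.pi ^ (-(1 / 2) : ℝ) * ∫ s in Set.Iic x, Real.exp (-s ^ 2) : ℝ) : ℂ)) ∧
      ∀ t : ℝ, ∃ U : L2R →L[ℂ] L2R,
        E.IsExpI t U ∧
        (∀ V : L2R →L[ℂ] L2R, E.IsExpI t V → V = U) ∧
        inner ℂ vacuum (U vacuum) = ((Real.exp (-t ^ 2 / 4) : ℝ) : ℂ) := by
  have hs : Measurable fun ξ : ℝ => 2 * Real.pi * ξ := by fun_prop
  refine ⟨mulResolution fourierL2R hs,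
    isMulModel_momentum.isSpectralIntegral hs Complex.continuous_ofReal.measurable,
    fun E' hE' => isMulModel_momentum.eq_mulResolution hs hE', fun x => ?_, fun t => ?_⟩
  · refine (inner_vacuum_conjMul (fun s => if s ≤ x then 1 else 0)
      (memLp_sublevelInd hs x)).trans ?_
    rw [Complex.ofReal_mul, ← integral_complex_ofReal, ← integral_indicator measurableSet_Iic]
    congr 1
    refine integral_congr_ae (Eventually.of_forall fun s => ?_)
    by_cases h : s ≤ x
    · simp [h]
    · simp [h]
  · have hU : (mulResolution fourierL2R hs).IsExpI t (conjMul fourierL2R (memLp_exp t)) :=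
      (isMulModel_conjMul fourierL2R (s := fun ξ => 2 * Real.pi * ξ)
        (φ := fun x => Complex.exp (Complex.I * t * x)) (memLp_exp t)).isSpectralIntegral hs
        (by fun_prop)
    refine ⟨_, hU, fun V hV => hU.unique hV, ?_⟩
    refine (inner_vacuum_conjMul (fun s => Complex.exp (Complex.I * t * s)) (memLp_exp t)).trans ?_
    have h1 := fourierIntegral_gaussian (b := 1) (by simp) t
    have h2 : ∫ s : ℝ, Complex.exp (Complex.I * t * s) * (Real.exp (-s ^ 2) : ℝ) =
        (Real.pi / 1 : ℂ) ^ (1 / 2 : ℂ) * Complex.exp (-t ^ 2 / (4 * 1)) := by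
      rw [← h1]
      refine integral_congr_ae (Eventually.of_forall fun s => ?_)
      simp
    have h3 : (Real.pi / 1 : ℂ) ^ (1 / 2 : ℂ) = ((Real.pi ^ (1 / 2 : ℝ) : ℝ) : ℂ) := by
      rw [Complex.ofReal_cpow Real.pi_pos.le]
      norm_num
    rw [h2, h3, ← mul_assoc, ← Complex.ofReal_mul, ← Real.rpow_add Real.pi_pos]
    norm_num

end
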